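/- Let $\tau$ be an infinite cardinal. All spaces are Hausdorff; a *compactum* is a compact Hausdorff space; a *condensation* of a space $A$ onto a space $B$ is a continuous bijection $A\to B$. Consider the following two properties of a space $X$: - $(A_\tau)$: for every $C\subseteq X$ with $|C|\le\tau$ there is a condensation of the subspace $X\setminus C$ onto a compactum; - $(SA_\tau)$: for every $C\subsetneq X$ with $|C|\le\tau$ there are a compactum $K$ and a condensation $f$ of $X\setminus C$ onto $K$ that extends to a continuous map $\tilde f:X\to K$. A compact space with $(A_\tau)$ is called an *$a_\tau$-space*, and a compact space with $(SA_\tau)$ a *strictly $a_\tau$-space*. A (not necessarily compact) space with $(A_\tau)$ is called *almost $a_\tau$-subcompact*, and one with $(SA_\tau)$ *almost strictly $a_\tau$-subcompact*. **Theorem.** Let $X=\bigoplus\{X_\alpha:\alpha\in\Lambda\}\cup\{\xi\}$ be a Hausdorff space, where $\xi\notin\bigcup_\alpha X_\alpha$ and the subspace $X\setminus\{\xi\}$ is the topological sum of the spaces $X_\alpha$ (no condition is put on the neighbourhoods of $\xi$; in particular $X$ need not be compact). If every $X_\alpha$ is an $a_\tau$-space, then 1. $X$ has property $(A_\tau)$,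 that is, $X$ is almost $a_\tau$-subcompact; 2. $X$ admits a condensation onto an $a_\tau$-space; 3. in particular, if $X$ is compact, then $X$ is an $a_\tau$-space. The same holds with "strictly $a_\tau$-space", "$(SA_\tau)$" and "almost strictly $a_\tau$-subcompact" in place of "$a_\tau$-space", "$(A_\tau)$" and "almost $a_\tau$-subcompact" throughout. -/

import Mathlib

open Cardinal Topology

universe u

/-- A condensation of `X` onto `Y`: a continuous bijection. -/
def IsCondensation {X Y : Type u} [TopologicalSpace X] [TopologicalSpace Y] (f : X → Y) : Prop :=
  Continuous f ∧ Function.Bijective f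

/-- A compactum: a compact Hausdorff space. -/
def IsCompactum (X : Type u) [TopologicalSpace X] : Prop :=
  CompactSpace X ∧ T2Space X

/-- A Hausdorff space `X` is almost `a_τ`-subcompact if for every `C ⊆ X` of cardinality at
most `τ` there is a condensation of the subspace `X \ C` onto a compactum.
(The target of a bijection may be taken in the universe of its source.) -/
def IsAlmostATauSubcompact (τ : Cardinal.{u}) (X : Type u) [TopologicalSpace X] : Prop :=
  T2Space X ∧ ∀ C : Set X, #C ≤ τ →
    ∃ (Y : Type u) (_ : TopologicalSpace Y) (f : (Cᶜ : Set X) → Y),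
      IsCompactum Y ∧ IsCondensation f

/-- A Hausdorff space `X` is almost strictly `a_τ`-subcompact if for every `C ⊆ X` of cardinality
at most `τ`, `C ≠ X`, there are a compactum `Y` and a condensation of `X \ C` onto `Y` that
extends to a continuous map `X → Y`. For `C = X` nothing is asked: the compactum would be empty,
and no map from a non-empty space to it exists. -/
def IsAlmostStrictlyATauSubcompact (τ : Cardinal.{u}) (X : Type u) [TopologicalSpace X] : Prop :=
  T2Space X ∧ ∀ C : Set X, #C ≤ τ → C ≠ Set.univ →
    ∃ (Y : Type u) (_ : TopologicalSpace Y) (f : (Cᶜ : Set X) → Y),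
      IsCompactum Y ∧ IsCondensation f ∧
        ∃ F : X → Y, Continuous F ∧ ∀ x : (Cᶜ : Set X), F x = f x

/-- An `a_τ`-space: a compact Hausdorff space `X` such that for every `C ⊆ X` of cardinality at
most `τ` there is a condensation of `X \ C` onto a compactum. -/
def IsATauSpace (τ : Cardinal.{u}) (X : Type u) [TopologicalSpace X] : Prop :=
  CompactSpace X ∧ IsAlmostATauSubcompact τ X

/-- A strictly `a_τ`-space: a compact Hausdorff space `X` such that for every `C ⊆ X` of
cardinality at most `τ`, `C ≠ X`, there is a condensation of `X \ C` onto a compactum `Y` that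
extends to a continuous map `X → Y`. -/
def IsStrictlyATauSpace (τ : Cardinal.{u}) (X : Type u) [TopologicalSpace X] : Prop :=
  CompactSpace X ∧ IsAlmostStrictlyATauSubcompact τ X

/-! Compact subsets of the sum are closed in `X`, so every neighbourhood of `ξ` in `OnePoint (Σ α, Z
α)` is one in `X`, and `X` condenses onto this one-point compactification. Both properties pull back
along a condensation, so only `OnePoint (Σ α, Z α)` matters. There, condense what `C` leaves of each
summand onto a compactum `K α` and send `∞` to `∞` (`OnePoint.condensesOn_sigma`). Continuity at `∞`
is automatic, since summands go to summands. If `C` contains `∞`, the image misses only `∞`, which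
is then glued to another point. The two versions differ only in the set `E` of `CondensesOn`: `Cᶜ`
or `univ`. -/

open Set OnePoint

/-- `A` is condensed onto a compactum by a map `X → Y` that is continuous on `E`. -/
def CondensesOn {X : Type u} [TopologicalSpace X] (A E : Set X) : Prop :=
  ∃ (Y : Type u) (_ : TopologicalSpace Y) (G : X → Y),
    IsCompactum Y ∧ ContinuousOn G E ∧ BijOn G A univ

theorem CondensesOn.of_condensation {X Y : Type u} [TopologicalSpace X] [TopologicalSpace Y]
    {g : X → Y} (hg : IsCondensation g) {A E : Set X} (h : CondensesOn (g '' A) (g '' E)) :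
    CondensesOn A E := by
  obtain ⟨K, _, G, hK, hc, hb⟩ := h
  exact ⟨K, _, G ∘ g, hK, hc.comp hg.1.continuousOn (mapsTo_image g E),
    hb.comp hg.2.1.injOn.bijOn_image⟩

/-- The case `C = univ` is free here, as the empty space is a compactum; excluding it matches the
strict version. -/
theorem isAlmostATauSubcompact_iff {τ : Cardinal.{u}} {X : Type u} [TopologicalSpace X] :
    IsAlmostATauSubcompact τ X ↔
      T2Space X ∧ ∀ C : Set X, #C ≤ τ → C ≠ Set.univ → CondensesOn Cᶜ Cᶜ := by
  refine and_congr_right fun _ => forall₂_congr fun C _ => ⟨fun h hC => ?_, fun h => ?_⟩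
  · obtain ⟨Y, _, f, hY, hf, hb⟩ := h
    classical
    obtain ⟨a, ha⟩ := nonempty_compl.2 hC
    -- The value off `Cᶜ` is arbitrary: continuity is asked only on `Cᶜ`.
    let G : X → Y := fun x => if h : x ∈ Cᶜ then f ⟨x, h⟩ else f ⟨a, ha⟩
    have hG : Cᶜ.domRestrict G = f := by
      ext x
      simp only [G, domRestrict_apply, dif_pos x.2]
    refine ⟨Y, _, G, hY, continuousOn_iff_continuous_domRestrict.2 (hG ▸ hf), mapsTo_univ _ _,
      injOn_iff_injective.2 (hG ▸ hb.1), surjOn_iff_surjective.2 ?_⟩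
    intro y
    obtain ⟨x, hx⟩ := hb.2 y
    exact ⟨x, by rw [← hx, ← congrFun hG x]⟩
  · by_cases hC : C = Set.univ
    · subst hC
      have : IsEmpty ((univ : Set X)ᶜ : Set X) := by simp
      exact ⟨PEmpty, ⊥, isEmptyElim, ⟨⟨by simp⟩, inferInstance⟩, continuous_of_const isEmptyElim,
        fun x => isEmptyElim x, fun y => y.elim⟩
    · obtain ⟨Y, _, G, hY, hc, hb⟩ := h hC
      exact ⟨Y, _, Cᶜ.domRestrict G, hY, hc.domRestrict, hb.injOn.injective,
        fun y => let ⟨x, hx, h⟩ := hb.surjOn (mem_univ y); ⟨⟨x, hx⟩, h⟩⟩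

theorem isAlmostStrictlyATauSubcompact_iff {τ : Cardinal.{u}} {X : Type u} [TopologicalSpace X] :
    IsAlmostStrictlyATauSubcompact τ X ↔
      T2Space X ∧ ∀ C : Set X, #C ≤ τ → C ≠ Set.univ → CondensesOn Cᶜ univ := by
  refine and_congr_right fun _ => forall₃_congr fun C _ _ => ⟨?_, ?_⟩
  · rintro ⟨Y, _, f, hY, ⟨-, hb⟩, F, hF, hFf⟩
    refine ⟨Y, _, F, hY, hF.continuousOn, mapsTo_univ _ _, fun x hx y hy h => ?_, fun y _ => ?_⟩
    · exact congrArg Subtype.val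
        (hb.1 ((hFf ⟨x, hx⟩).symm.trans (h.trans (hFf ⟨y, hy⟩)) : f ⟨x, hx⟩ = f ⟨y, hy⟩))
    · obtain ⟨x, hx⟩ := hb.2 y
      exact ⟨x, x.2, (hFf x).trans hx⟩
  · rintro ⟨Y, _, G, hY, hc, hb⟩
    have hG : Continuous G := continuousOn_univ.1 hc
    exact ⟨Y, _, Cᶜ.domRestrict G, hY, ⟨hG.comp continuous_subtype_val, hb.injOn.injective,
      fun y => let ⟨x, hx, h⟩ := hb.surjOn (mem_univ y); ⟨⟨x, hx⟩, h⟩⟩, G, hG, fun _ => rfl⟩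

/-- Identifying the points of a finite subset of a compactum gives a compactum. -/
theorem IsCompactum.coinduced {Q Y : Type u} [TopologicalSpace Q] (hQ : IsCompactum Q)
    {q : Q → Y} (hq : Function.Surjective q) {F : Set Q} (hF : F.Finite)
    (hqF : ∀ x y, q x = q y ↔ x = y ∨ x ∈ F ∧ y ∈ F) :
    @IsCompactum Y (TopologicalSpace.coinduced q inferInstance) := by
  let t : TopologicalSpace Y := TopologicalSpace.coinduced q inferInstance
  have := hQ.1
  have := hQ.2
  -- An open set that contains all of `F` or none of it is saturated.
  have hopen {W : Set Q} (hW : IsOpen W) (h : ∀ x ∈ F, ∀ y ∈ F, x ∈ W → y ∈ W) :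
      IsOpen (q '' W) := by
    rw [isOpen_coinduced]
    convert hW using 1
    refine Subset.antisymm ?_ (subset_preimage_image q W)
    rintro x ⟨y, hy, hyx⟩
    rcases (hqF y x).1 hyx with rfl | ⟨hyF, hxF⟩
    · exact hy
    · exact h y hyF x hxF hy
  have hsep (x y : Q) (hx : x ∉ F) (hxy : x ≠ y) :
      ∃ u v : Set Y, IsOpen u ∧ IsOpen v ∧ q x ∈ u ∧ q y ∈ v ∧ Disjoint u v := by
    -- Putting all of `F` into `V` makes both `U` and `V` saturated.
    obtain ⟨U, V, hU, hV, hxU, hFV, hd⟩ := SeparatedNhds.of_finite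
      (s := {x}) (t := insert y F) (toFinite _) (hF.insert y) (by simp [hx, hxy])
    rw [insert_subset_iff] at hFV
    refine ⟨q '' U, q '' V, hopen hU ?_, hopen hV fun _ _ b hb _ => hFV.2 hb,
      mem_image_of_mem q (hxU rfl), mem_image_of_mem q hFV.1, ?_⟩
    · exact fun a ha _ _ h => (disjoint_left.1 hd h (hFV.2 ha)).elim
    · rw [disjoint_left]
      rintro _ ⟨a, ha, rfl⟩ ⟨b, hb, hab⟩
      rcases (hqF b a).1 hab with rfl | ⟨-, haF⟩
      · exact disjoint_left.1 hd ha hb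
      · exact disjoint_left.1 hd ha (hFV.2 haF)
  refine ⟨hq.compactSpace continuous_coinduced_rng, ⟨fun x y hxy => ?_⟩⟩
  obtain ⟨x, rfl⟩ := hq x
  obtain ⟨y, rfl⟩ := hq y
  have hne : x ≠ y := fun h => hxy (congrArg q h)
  by_cases hx : x ∈ F
  · obtain ⟨u, v, hu, hv, h1, h2, hd⟩ :=
      hsep y x (fun hy => hxy ((hqF x y).2 (Or.inr ⟨hx, hy⟩))) hne.symm
    exact ⟨v, u, hv, hu, h2, h1, hd.symm⟩
  · exact hsep x y hx hne

/-- Gluing the point at infinity of a one-point compactification to one of the other points. -/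
theorem OnePoint.exists_compactum_identify_infty {S : Type u} [TopologicalSpace S]
    [T2Space (OnePoint S)] (s₀ : S) :
    ∃ (Y : Type u) (_ : TopologicalSpace Y) (q : OnePoint S → Y),
      IsCompactum Y ∧ Continuous q ∧ BijOn q (range OnePoint.some) univ := by
  have hQ : IsCompactum (OnePoint S) := ⟨inferInstance, inferInstance⟩
  -- The quotient is the set `S` with a new topology; the quotient map is the identity on `S`.
  refine ⟨S, .coinduced (fun x : OnePoint S => x.elim s₀ id) inferInstance, _,
    hQ.coinduced (fun s => ⟨s, rfl⟩) (toFinite {∞, (s₀ : OnePoint S)}) fun x y => ?_,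
    continuous_coinduced_rng, mapsTo_univ _ _, ?_, fun s _ => ⟨s, mem_range_self s, rfl⟩⟩
  · induction x <;> induction y <;> simp [eq_comm]
    grind
  · rintro _ ⟨x, rfl⟩ _ ⟨y, rfl⟩ h
    exact congrArg OnePoint.some h

theorem IsCompact.finite_image_sigma_fst {ι : Type*} {K : ι → Type*}
    [∀ i, TopologicalSpace (K i)] {T : Set (Σ i, K i)} (hT : IsCompact T) :
    (Sigma.fst '' T).Finite := by
  let : TopologicalSpace ι := ⊥
  have : DiscreteTopology ι := ⟨rfl⟩
  exact (hT.image (continuous_sigma fun _ => continuous_const)).finite_of_discrete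

/-- Used to make the one-point compactification of the sum Hausdorff. -/
theorem Sigma.weaklyLocallyCompactSpace {ι : Type*} {K : ι → Type*}
    [∀ i, TopologicalSpace (K i)] [∀ i, CompactSpace (K i)] :
    WeaklyLocallyCompactSpace (Σ i, K i) :=
  ⟨fun x => ⟨range (Sigma.mk x.1), isCompact_range continuous_sigmaMk,
    isOpen_range_sigmaMk.mem_nhds ⟨x.2, rfl⟩⟩⟩

section Sum

variable {ι : Type*} {Z K : ι → Type*}

/-- The map between one-point extensions of sums that fixes `∞` and is `H i` on the summand
with index `i`. -/
def OnePoint.sigmaMap (H : ∀ i, Z i → OnePoint (K i)) (x : OnePoint (Σ i, Z i)) :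
    OnePoint (Σ i, K i) :=
  x.elim ∞ fun s => (H s.1 s.2).map (Sigma.mk s.1)

theorem OnePoint.sigmaMap_coe (H : ∀ i, Z i → OnePoint (K i)) (i : ι) (z : Z i) :
    OnePoint.sigmaMap H ((⟨i, z⟩ : Σ i, Z i) : OnePoint (Σ i, Z i)) =
      (H i z).map (Sigma.mk i) := rfl

theorem OnePoint.bijOn_sigmaMap {H : ∀ i, Z i → OnePoint (K i)}
    {A : Set (OnePoint (Σ i, Z i))} (hA : ∞ ∉ A)
    (hH : ∀ i, BijOn (H i) {z | ((⟨i, z⟩ : Σ i, Z i) : OnePoint (Σ i, Z i)) ∈ A}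
      (range OnePoint.some)) :
    BijOn (OnePoint.sigmaMap H) A (range OnePoint.some) := by
  refine ⟨?_, ?_, ?_⟩
  · intro x hx
    induction x with
    | infty => exact absurd hx hA
    | coe x =>
      obtain ⟨k, hk⟩ := (hH x.1).mapsTo hx
      exact ⟨⟨x.1, k⟩, by rw [sigmaMap_coe, ← hk, map_some]⟩
  · intro x hx y hy h
    induction x with
    | infty => exact absurd hx hA
    | coe x =>
      induction y with
      | infty => exact absurd hy hA
      | coe y =>
        obtain ⟨i, x⟩ := x
        obtain ⟨j, y⟩ := y
        obtain ⟨k, hk⟩ := (hH i).mapsTo hx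
        obtain ⟨l, hl⟩ := (hH j).mapsTo hy
        rw [sigmaMap_coe, sigmaMap_coe, ← hk, ← hl, map_some, map_some, coe_eq_coe] at h
        obtain rfl : i = j := congrArg Sigma.fst h
        obtain rfl := sigma_mk_injective h
        rw [(hH i).injOn hx hy (hk.symm.trans hl)]
  · rintro _ ⟨⟨i, k⟩, rfl⟩
    obtain ⟨z, hz, h⟩ := (hH i).surjOn (mem_range_self k)
    exact ⟨_, hz, by rw [sigmaMap_coe, h, map_some]⟩

variable [∀ i, TopologicalSpace (Z i)] [∀ i, TopologicalSpace (K i)]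

/-- At `∞` nothing is needed of `H i`: a compact set meets finitely many summands, and all the other
summands are mapped off it. -/
theorem OnePoint.continuousOn_sigmaMap [∀ i, CompactSpace (Z i)] [∀ i, T2Space (K i)]
    {H : ∀ i, Z i → OnePoint (K i)} {E : Set (OnePoint (Σ i, Z i))}
    (hH : ∀ i, ContinuousOn (H i) {z | ((⟨i, z⟩ : Σ i, Z i) : OnePoint (Σ i, Z i)) ∈ E}) :
    ContinuousOn (OnePoint.sigmaMap H) E := by
  intro x hx
  induction x with
  | infty =>
    refine ContinuousAt.continuousWithinAt ?_
    refine (hasBasis_nhds_infty (X := Σ i, K i)).tendsto_right_iff.2 ?_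
    rintro T ⟨-, hT⟩
    have hfin := hT.finite_image_sigma_fst
    have hN : IsOpen ((OnePoint.some '' ((Sigma.fst '' T).sigma fun i => univ : Set (Σ i, Z i)))ᶜ) := by
      refine isOpen_compl_image_coe.2 ⟨?_, isCompact_sigma hfin fun i _ => isCompact_univ⟩
      rw [isClosed_sigma_iff]
      intro i
      by_cases hi : i ∈ Sigma.fst '' T
      · rw [mk_preimage_sigma hi]
        exact isClosed_univ
      · rw [mk_preimage_sigma_eq_empty hi]
        exact isClosed_empty
    filter_upwards [hN.mem_nhds infty_notMem_image_coe] with y hy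
    induction y with
    | infty => exact Or.inr rfl
    | coe y =>
      obtain ⟨i, z⟩ := y
      rw [sigmaMap_coe]
      cases h : H i z with
      | infty => exact Or.inr rfl
      | coe k =>
        refine Or.inl ⟨⟨i, k⟩, fun hk => hy ⟨⟨i, z⟩, ⟨⟨_, hk, rfl⟩, mem_univ _⟩, rfl⟩, rfl⟩
  | coe x =>
    obtain ⟨i, z⟩ := x
    have hemb : IsOpenEmbedding fun z : Z i => ((⟨i, z⟩ : Σ i, Z i) : OnePoint (Σ i, Z i)) :=
      isOpenEmbedding_coe.comp .sigmaMk
    have hmap : Continuous (OnePoint.map (Sigma.mk i : K i → Σ i, K i)) :=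
      by
      refine continuous_map continuous_sigmaMk ?_
      rw [Filter.coclosedCompact_eq_cocompact, Filter.coclosedCompact_eq_cocompact]
      exact IsClosedEmbedding.sigmaMk.tendsto_cocompact
    have := hmap.continuousAt.comp_continuousWithinAt (hH i z hx)
    rw [ContinuousWithinAt, ← hemb.map_nhdsWithin_preimage_eq, Filter.tendsto_map'_iff]
    exact this

end Sum

theorem OnePoint.condensesOn_sigma {ι : Type u} {Z : ι → Type u} [∀ i, TopologicalSpace (Z i)]
    [∀ i, CompactSpace (Z i)] {A E : Set (OnePoint (Σ i, Z i))} (hne : A.Nonempty)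
    (h : ∀ i, {z | ((⟨i, z⟩ : Σ i, Z i) : OnePoint (Σ i, Z i)) ∈ A}.Nonempty →
      CondensesOn {z | ((⟨i, z⟩ : Σ i, Z i) : OnePoint (Σ i, Z i)) ∈ A}
        {z | ((⟨i, z⟩ : Σ i, Z i) : OnePoint (Σ i, Z i)) ∈ E}) :
    CondensesOn A E := by
  have h' (i : ι) : ∃ (K : Type u) (_ : TopologicalSpace K) (H : Z i → OnePoint K),
      IsCompactum K ∧
      ContinuousOn H {z | ((⟨i, z⟩ : Σ i, Z i) : OnePoint (Σ i, Z i)) ∈ E} ∧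
      BijOn H {z | ((⟨i, z⟩ : Σ i, Z i) : OnePoint (Σ i, Z i)) ∈ A} (range OnePoint.some) := by
    rcases eq_empty_or_nonempty {z | ((⟨i, z⟩ : Σ i, Z i) : OnePoint (Σ i, Z i)) ∈ A} with he | hn
    -- A summand that misses `A` has no compactum to map to, so it collapses to `∞`; hence the
    -- values in `OnePoint K`.
    · refine ⟨PEmpty, ⊥, fun _ => ∞, ⟨⟨by simp⟩, inferInstance⟩, continuousOn_const, ?_⟩
      rw [he, range_eq_empty]
      exact bijOn_empty _
    · obtain ⟨K, _, H, hK, hc, hb⟩ := h i hn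
      refine ⟨K, _, OnePoint.some ∘ H, hK, continuous_coe.comp_continuousOn hc, ?_⟩
      rw [← image_univ]
      exact coe_injective.injOn.bijOn_image.comp hb
  choose K tK H hK hc hb using h'
  have (i : ι) : CompactSpace (K i) := (hK i).1
  have (i : ι) : T2Space (K i) := (hK i).2
  have : WeaklyLocallyCompactSpace (Σ i, K i) := Sigma.weaklyLocallyCompactSpace
  have hG := OnePoint.continuousOn_sigmaMap hc
  by_cases hA : ∞ ∈ A
  · refine ⟨_, _, OnePoint.sigmaMap H, ⟨inferInstance, inferInstance⟩, hG, ?_⟩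
    have hB : BijOn (OnePoint.sigmaMap H) (A \ {∞}) (range OnePoint.some) :=
      OnePoint.bijOn_sigmaMap (by simp) fun i => by simpa using hb i
    have := hB.insert (a := ∞) infty_notMem_range_coe
    rwa [insert_sdiff_singleton, insert_eq_of_mem hA,
      show OnePoint.sigmaMap H ∞ = ∞ from rfl, insert_infty_range_coe] at this
  · have hB := OnePoint.bijOn_sigmaMap hA hb
    obtain ⟨a, ha⟩ := hne
    -- Since `A` is nonempty, there is a point to which `∞` can be glued.
    obtain ⟨s₀, -⟩ := hB.mapsTo ha
    obtain ⟨Y, _, q, hY, hq, hqb⟩ := OnePoint.exists_compactum_identify_infty s₀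
    exact ⟨Y, _, q ∘ OnePoint.sigmaMap H, hY, hq.comp_continuousOn hG, hqb.comp hB⟩

/-- A Hausdorff space that is a sum of compact spaces and one more point condenses onto the
one-point compactification of the sum. -/
theorem exists_condensation_onePoint {S X : Type u} [TopologicalSpace S] [TopologicalSpace X]
    [T2Space X] {ξ : X} {e : S → X} (he : IsEmbedding e) (hξ : range e = {ξ}ᶜ) :
    ∃ g : X → OnePoint S, IsCondensation g := by
  let h : OnePoint S → X := fun x => x.elim ξ e
  have hne (s : S) : e s ≠ ξ := by simpa [hξ] using mem_range_self (f := e) s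
  have hb : Function.Bijective h := by
    refine ⟨fun x y hxy => ?_, fun x => ?_⟩
    · induction x with
      | infty =>
        induction y with
        | infty => rfl
        | coe y => exact absurd hxy.symm (hne y)
      | coe x =>
        induction y with
        | infty => exact absurd hxy (hne x)
        | coe y => exact congrArg _ (he.injective hxy)
    · by_cases hx : x = ξ
      · exact ⟨∞, hx.symm⟩
      · obtain ⟨s, hs⟩ : x ∈ range e := hξ ▸ hx
        exact ⟨s, hs⟩
  have hcomp (U : Set S) : h '' (OnePoint.some '' U) = e '' U := by
    rw [image_image]; rfl
  -- Openness of `h` is continuity of its inverse, the desired condensation. For `U` containing `∞`,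
  -- the complement of the image is compact, hence closed in the Hausdorff space `X`.
  have hopen : IsOpenMap h := by
    intro U hU
    by_cases hU' : ∞ ∈ U
    · rw [← compl_compl U, image_compl_eq hb, isOpen_compl_iff]
      have hUc : Uᶜ = OnePoint.some '' (OnePoint.some ⁻¹' U)ᶜ := by
        rw [← preimage_compl, image_preimage_eq_of_subset]
        rw [← compl_infty]
        exact fun x hx hx' => hx (hx' ▸ hU')
      rw [hUc, hcomp]
      exact (((isOpen_iff_of_mem hU').1 hU).2.image he.continuous).isClosed
    · have hUc : U = OnePoint.some '' (OnePoint.some ⁻¹' U) := by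
        rw [image_preimage_eq_of_subset]
        rw [← compl_infty]
        exact fun x hx hx' => hU' (hx' ▸ hx)
      rw [hUc, hcomp]
      exact (IsOpenEmbedding.mk he (hξ ▸ isOpen_compl_singleton)).isOpenMap _
        (hU.preimage continuous_coe)
  let E := Equiv.ofBijective h hb
  refine ⟨E.symm, ⟨fun U hU => ?_⟩, E.symm.bijective⟩
  rw [← E.image_eq_preimage_symm]
  exact hopen U hU

/-- `X = ⨁ Z α ∪ {ξ}`: the topological sum of the spaces `Z α` is embedded by `e` in the Hausdorff
space `X`, and `ξ` is the only point of `X` outside it. -/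
theorem theorem2p17 (τ : Cardinal.{u}) (hτ : ℵ₀ ≤ τ)
    (Λ : Type u) (Z : Λ → Type u) [∀ α, TopologicalSpace (Z α)]
    (X : Type u) [TopologicalSpace X] [T2Space X] (ξ : X)
    (e : (Σ α, Z α) → X) (he : IsEmbedding e) (hξ : Set.range e = {ξ}ᶜ) :
    ((∀ α, IsATauSpace τ (Z α)) →
      IsAlmostATauSubcompact τ X ∧
      (∃ (Y : Type u) (_ : TopologicalSpace Y) (g : X → Y),
        IsATauSpace τ Y ∧ IsCondensation g) ∧
      (CompactSpace X → IsATauSpace τ X)) ∧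
    ((∀ α, IsStrictlyATauSpace τ (Z α)) →
      IsAlmostStrictlyATauSubcompact τ X ∧
      (∃ (Y : Type u) (_ : TopologicalSpace Y) (g : X → Y),
        IsStrictlyATauSpace τ Y ∧ IsCondensation g) ∧
      (CompactSpace X → IsStrictlyATauSpace τ X)) := by
  obtain ⟨g, hg⟩ := exists_condensation_onePoint he hξ
  have hmk (α : Λ) : Function.Injective
      fun z : Z α => ((⟨α, z⟩ : Σ α, Z α) : OnePoint (Σ α, Z α)) :=
    coe_injective.comp sigma_mk_injective
  constructor
  · intro hZ
    have (α : Λ) : CompactSpace (Z α) := (hZ α).1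
    have (α : Λ) : T2Space (Z α) := (hZ α).2.1
    have : WeaklyLocallyCompactSpace (Σ α, Z α) := Sigma.weaklyLocallyCompactSpace
    have hP : ∀ C : Set (OnePoint (Σ α, Z α)), #C ≤ τ → C ≠ Set.univ → CondensesOn Cᶜ Cᶜ := by
      refine fun C hC hC' => OnePoint.condensesOn_sigma (nonempty_compl.2 hC') fun α hα => ?_
      exact (isAlmostATauSubcompact_iff.1 (hZ α).2).2 _
        ((mk_preimage_of_injective _ C (hmk α)).trans hC) (nonempty_compl.1 hα)
    have hX : IsAlmostATauSubcompact τ X := by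
      refine isAlmostATauSubcompact_iff.2 ⟨inferInstance, fun C hC hC' => .of_condensation hg ?_⟩
      rw [image_compl_eq hg.2]
      refine hP _ (mk_image_le.trans hC) (nonempty_compl.1 ?_)
      rw [← image_compl_eq hg.2]
      exact (nonempty_compl.2 hC').image g
    exact ⟨hX, ⟨_, _, g, ⟨inferInstance, isAlmostATauSubcompact_iff.2 ⟨inferInstance, hP⟩⟩, hg⟩,
      fun h => ⟨h, hX⟩⟩
  · intro hZ
    have (α : Λ) : CompactSpace (Z α) := (hZ α).1
    have (α : Λ) : T2Space (Z α) := (hZ α).2.1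
    have : WeaklyLocallyCompactSpace (Σ α, Z α) := Sigma.weaklyLocallyCompactSpace
    have hP : ∀ C : Set (OnePoint (Σ α, Z α)), #C ≤ τ → C ≠ Set.univ → CondensesOn Cᶜ univ := by
      refine fun C hC hC' => OnePoint.condensesOn_sigma (nonempty_compl.2 hC') fun α hα => ?_
      exact (isAlmostStrictlyATauSubcompact_iff.1 (hZ α).2).2 _
        ((mk_preimage_of_injective _ C (hmk α)).trans hC) (nonempty_compl.1 hα)
    have hX : IsAlmostStrictlyATauSubcompact τ X := by
      refine isAlmostStrictlyATauSubcompact_iff.2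
        ⟨inferInstance, fun C hC hC' => .of_condensation hg ?_⟩
      rw [image_compl_eq hg.2, image_univ_of_surjective hg.2.2]
      refine hP _ (mk_image_le.trans hC) (nonempty_compl.1 ?_)
      rw [← image_compl_eq hg.2]
      exact (nonempty_compl.2 hC').image g
    exact ⟨hX, ⟨_, _, g, ⟨inferInstance, isAlmostStrictlyATauSubcompact_iff.2
      ⟨inferInstance, hP⟩⟩, hg⟩, fun h => ⟨h, hX⟩⟩
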